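/- Let $s\ge 2$ and let $d_1,\dots,d_s>1$ be integers with product $d=d_1\cdots d_s$. For a prime $p$ put $A=(\mathbb{Z}/p)[x_1,\dots,x_s]$ and $h=\sum_i x_i^{d_i}\in A$. For $n\ge 0$ and $q=p^n$ let $e_n$ be the length of $A/(h,x_1^q,\dots,x_s^q)$, and for integers $k_1,\dots,k_s\ge 0$ let $D_p(k_1,\dots,k_s)$ be the length of $A/(\sum_i x_i,\,x_1^{k_1},\dots,x_s^{k_s})$. For each fixed $p$ the limit $\mu=\mu_p=\lim_{n\to\infty} e_n/q^{s-1}$ (the Hilbert-Kunz multiplicity of $h$) exists, and $e_n=\mu q^{s-1}+O(q^{s-2})$ as $n\to\infty$. Suppose that for each prime $p$ we are given integers $a_1,\dots,a_s\ge 0$ (depending on $p$) with $a_i=\frac{p}{d_i}+O(1)$, i.e. $|a_i-\frac{p}{d_i}|$ is bounded independently of $p$ and $i$. Then there is a constant $k$ such that for all primes $p$ $$\left|\,\mu_p-d\,p^{1-s}D_p(a_1,\dots,a_s)\right|\le\frac{k}{p}.$$ -/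

import Mathlib

open Filter Topology Asymptotics

namespace HilbertKunz

/-- The colength of an ideal `I`: the length of the `R`-module `R ⧸ I`, as a natural number.
It is used below only for ideals of finite colength, see `length_ne_top`. -/
noncomputable def colength {R : Type*} [CommRing R] (I : Ideal R) : ℕ :=
  (Module.length R (R ⧸ I)).toNat

/-- The ideal `(f, x_1 ^ k_1, …, x_s ^ k_s)` of `(ℤ/p)[x_1, …, x_s]`. -/
noncomputable def powIdeal {p s : ℕ} (f : MvPolynomial (Fin s) (ZMod p)) (k : Fin s → ℕ) :
    Ideal (MvPolynomial (Fin s) (ZMod p)) :=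
  Ideal.span (insert f (Set.range fun i => MvPolynomial.X i ^ k i))

/-- The ideals `powIdeal f k` have finite colength. -/
theorem length_ne_top {p s : ℕ} [Fact p.Prime] (f : MvPolynomial (Fin s) (ZMod p))
    (k : Fin s → ℕ) :
    Module.length (MvPolynomial (Fin s) (ZMod p))
      (MvPolynomial (Fin s) (ZMod p) ⧸ powIdeal f k) ≠ ⊤ := by
  set I := powIdeal f k with hI
  set g := Ideal.Quotient.mkₐ (ZMod p) I with hg
  have hfin : Module.Finite (ZMod p) (MvPolynomial (Fin s) (ZMod p) ⧸ I) := by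
    have hint : ∀ x ∈ Set.range (fun i => g (MvPolynomial.X i)), IsIntegral (ZMod p) x := by
      rintro _ ⟨i, rfl⟩
      have h0 : (g (MvPolynomial.X i)) ^ (k i + 1) = 0 := by
        rw [← map_pow, hg, Ideal.Quotient.mkₐ_eq_mk, Ideal.Quotient.eq_zero_iff_mem, pow_succ]
        exact I.mul_mem_right _ (Ideal.subset_span (Set.mem_insert_of_mem _ ⟨i, rfl⟩))
      refine IsIntegral.of_pow (Nat.succ_pos (k i)) ?_
      rw [h0]
      exact isIntegral_zero
    have hadj := Algebra.finite_adjoin_of_finite_of_isIntegral (Set.finite_range _) hint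
    have htop : Algebra.adjoin (ZMod p) (Set.range fun i => g (MvPolynomial.X i)) = ⊤ := by
      have h1 : (Set.range fun i => g (MvPolynomial.X i)) = g '' Set.range MvPolynomial.X := by
        rw [← Set.range_comp]; rfl
      rw [h1, Algebra.adjoin_image, MvPolynomial.adjoin_range_X, Algebra.map_top,
        AlgHom.range_eq_top]
      exact Ideal.Quotient.mkₐ_surjective _ _
    rw [htop] at hadj
    exact Module.Finite.equiv (Subalgebra.topEquiv (R := ZMod p)).toLinearEquiv
  have : IsArtinian (MvPolynomial (Fin s) (ZMod p)) (MvPolynomial (Fin s) (ZMod p) ⧸ I) :=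
    isArtinian_of_tower (ZMod p) inferInstance
  have : IsNoetherian (MvPolynomial (Fin s) (ZMod p)) (MvPolynomial (Fin s) (ZMod p) ⧸ I) :=
    isNoetherian_of_tower (ZMod p) inferInstance
  exact Module.length_ne_top

/-- `D_p(k_1, …, k_s)`, the length of `(ℤ/p)[x_1, …, x_s] / (∑ x_i, x_1 ^ k_1, …, x_s ^ k_s)`. -/
noncomputable def D (p : ℕ) {s : ℕ} (k : Fin s → ℕ) : ℕ :=
  colength (powIdeal (p := p) (∑ i, MvPolynomial.X i) k)

/-- The diagonal hypersurface `h = ∑ x_i ^ d_i` over `ℤ/p`. -/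
noncomputable def diagonal (p : ℕ) {s : ℕ} (d : Fin s → ℕ) : MvPolynomial (Fin s) (ZMod p) :=
  ∑ i, MvPolynomial.X i ^ d i

/-- `e_n(f)`, the colength of the ideal generated by `f` and the `x_i ^ q`, `q = p ^ n`. -/
noncomputable def e {p s : ℕ} (f : MvPolynomial (Fin s) (ZMod p)) (n : ℕ) : ℕ :=
  colength (powIdeal f fun _ => p ^ n)

/-- The Hilbert-Kunz multiplicity of `f`: the limit of `e_n(f) / q ^ (s - 1)`, `q = p ^ n`, as
`n → ∞`. -/
noncomputable def multiplicity {p s : ℕ} (f : MvPolynomial (Fin s) (ZMod p)) : ℝ :=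
  limUnder atTop fun n : ℕ => (e f n : ℝ) / ((p : ℝ) ^ n) ^ (s - 1)

end HilbertKunz

/-! Write `q = p ^ n` and `P = ∏ d i`. Three facts about colengths carry the proof. (1) The
polynomial ring is free of rank `P` over its image under `X i ↦ X i ^ d i`, so `(h, x_i ^ (d i * κ
i))` has colength `P * D p κ` (`colength_diagonal`). (2) Raising one exponent by 1 changes `D` by at
most `M ^ (s - 2)` if all exponents are at most `M` (`D_update_succ_le`). (3) Frobenius gives `D p
(p • κ) = p ^ (s - 1) * D p κ` (`D_prime_mul`). If `κ i` is within `N` of `q / d i`, then `p ^ j * κ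
i` is within `p ^ j * N` of `p ^ (n + j) / d i`. By (1) and (2), `e_{n+j}` is then close to `P * D p
(p ^ j • κ)`, which (3) evaluates; after normalization the error is `O(1 / q)`, uniformly in `j` and
`p` (`abs_e_diagonal_div_sub_le`). Rounding down `q / d i` shows that the limit exists and gives the
asymptotics of `e_n`; `n = 1` and `κ = a` give the bound on `μ`. -/

namespace HilbertKunz

/-! ### Length over the polynomial ring versus dimension over the field -/

section Length

variable {k σ M : Type*} [Field k]

/-- A simple module over a polynomial ring on which all variables act nilpotently is
one-dimensional over the field of coefficients. -/
theorem length_eq_one_of_isSimpleModule [AddCommGroup M] [Module (MvPolynomial σ k) M] [Module k M]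
    [IsScalarTower k (MvPolynomial σ k) M] [IsSimpleModule (MvPolynomial σ k) M]
    (h : ∀ i, ∃ n : ℕ, ∀ m : M, (MvPolynomial.X i : MvPolynomial σ k) ^ n • m = 0) :
    Module.length k M = 1 := by
  have hX : ∀ i, ∀ m : M, (MvPolynomial.X i : MvPolynomial σ k) • m = 0 := by
    intro i
    let f : M →ₗ[MvPolynomial σ k] M := LinearMap.lsmul _ M (MvPolynomial.X i)
    -- Schur's lemma; nilpotency excludes the bijective case.
    rcases LinearMap.bijective_or_eq_zero f with hf | hf
    · exfalso
      obtain ⟨n, hn⟩ := h i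
      have := IsSimpleModule.nontrivial (MvPolynomial σ k) M
      obtain ⟨m, hm⟩ := exists_ne (0 : M)
      have hinj : Function.Injective (f ^ n) := by
        rw [Module.End.coe_pow]
        exact hf.1.iterate n
      have hpow : (f ^ n) m = (MvPolynomial.X i : MvPolynomial σ k) ^ n • m := by
        have : f = algebraMap (MvPolynomial σ k) (Module.End _ M) (MvPolynomial.X i) := rfl
        rw [this, ← map_pow]; rfl
      exact hm (hinj (by rw [hpow, hn, map_zero]))
    · intro m
      exact LinearMap.congr_fun hf m
  have hC : ∀ (f : MvPolynomial σ k) (m : M), f • m = MvPolynomial.constantCoeff f • m := by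
    intro f
    induction f using MvPolynomial.induction_on with
    | C a =>
      intro m
      rw [MvPolynomial.constantCoeff_C, ← MvPolynomial.algebraMap_eq, algebraMap_smul]
    | add p q hp hq => intro m; rw [add_smul, hp, hq, map_add, add_smul]
    | mul_X p i hp => intro m; rw [mul_smul, hX, smul_zero]; simp
  have : IsSimpleModule k M := by
    have e : Submodule k M ≃o Submodule (MvPolynomial σ k) M :=
      { toFun := fun N =>
          { N with smul_mem' := fun f m hm => (hC f m).symm ▸ N.smul_mem _ hm }
        invFun := fun N => N.restrictScalars k
        left_inv := fun _ => rfl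
        right_inv := fun _ => rfl
        map_rel_iff' := Iff.rfl }
    exact (isSimpleModule_iff k M).2 e.isSimpleOrder
  exact Module.length_eq_one k M

/-- Both lengths are additive along a composition series, and every simple factor is
one-dimensional. This turns colengths into `finrank`s. -/
theorem length_eq_length_field [AddCommGroup M] [Module (MvPolynomial σ k) M] [Module k M]
    [IsScalarTower k (MvPolynomial σ k) M] (hfin : IsFiniteLength (MvPolynomial σ k) M)
    (h : ∀ i, ∃ n : ℕ, ∀ m : M, (MvPolynomial.X i : MvPolynomial σ k) ^ n • m = 0) :
    Module.length (MvPolynomial σ k) M = Module.length k M := by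
  rename_i instG instA instK instT
  revert instK
  induction hfin with
  | of_subsingleton => intros; rw [Module.length_eq_zero, Module.length_eq_zero]
  | @of_simple_quotient M _ _ N _ hN ih =>
    intro instK instT
    rw [Module.length_eq_add_of_exact N.subtype N.mkQ N.injective_subtype N.mkQ_surjective
        (LinearMap.exact_subtype_mkQ N),
      Module.length_eq_add_of_exact (N.subtype.restrictScalars k) (N.mkQ.restrictScalars k)
        N.injective_subtype N.mkQ_surjective (LinearMap.exact_subtype_mkQ N)]
    have hsub : ∀ i, ∃ n : ℕ, ∀ m : N, (MvPolynomial.X i : MvPolynomial σ k) ^ n • m = 0 := by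
      intro i
      obtain ⟨n, hn⟩ := h i
      exact ⟨n, fun m => Subtype.ext (hn m)⟩
    have hquot : ∀ i, ∃ n : ℕ, ∀ m : M ⧸ N, (MvPolynomial.X i : MvPolynomial σ k) ^ n • m = 0 := by
      intro i
      obtain ⟨n, hn⟩ := h i
      refine ⟨n, fun m => ?_⟩
      obtain ⟨m, rfl⟩ := N.mkQ_surjective m
      rw [← map_smul, hn, map_zero]
    rw [ih hsub, Module.length_eq_one (MvPolynomial σ k) (M ⧸ N),
      length_eq_one_of_isSimpleModule hquot]

end Length

/-! ### Freeness over the image of `X i ↦ X i ^ d i` -/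

section Substitution

open MvPolynomial

variable {k σ : Type*} [Field k] [Fintype σ]

/-- The substitution `X i ↦ X i ^ d i`. -/
noncomputable def substPow (k : Type*) [Field k] {σ : Type*} (d : σ → ℕ) :
    MvPolynomial σ k →ₐ[k] MvPolynomial σ k :=
  aeval fun i => X i ^ d i

@[simp] theorem substPow_X {σ : Type*} (d : σ → ℕ) (i : σ) :
    substPow k d (X i) = X i ^ d i := aeval_X _ _

/-- The exponent `d i * u i + r i`. -/
noncomputable def scaleAdd (d : σ → ℕ) (u : σ →₀ ℕ) (r : ∀ i, Fin (d i)) : σ →₀ ℕ :=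
  Finsupp.equivFunOnFinite.symm fun i => d i * u i + r i

theorem scaleAdd_injective {d : σ → ℕ} {u v : σ →₀ ℕ} {r t : ∀ i, Fin (d i)}
    (h : scaleAdd d u r = scaleAdd d v t) : u = v ∧ r = t := by
  have h' : ∀ i, d i * u i + r i = d i * v i + t i := fun i => DFunLike.congr_fun h i
  have hpos : ∀ i, 0 < d i := fun i => (Nat.zero_le _).trans_lt (r i).2
  constructor
  · ext i
    have := congrArg (· / d i) (h' i)
    simpa [Nat.mul_add_div (hpos i), Nat.div_eq_of_lt] using this
  · ext i
    have := congrArg (· % d i) (h' i)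
    simpa [Nat.mul_add_mod, Nat.mod_eq_of_lt] using this

theorem substPow_monomial_mul (d : σ → ℕ) (u : σ →₀ ℕ) (r : ∀ i, Fin (d i)) (c : k) :
    substPow k d (monomial u c) * monomial (Finsupp.equivFunOnFinite.symm fun i => (r i : ℕ)) 1
      = monomial (scaleAdd d u r) c := by
  rw [substPow, aeval_monomial, Finsupp.prod_fintype _ _ (fun _ => pow_zero _), monomial_eq,
    monomial_eq, Finsupp.prod_fintype _ _ (fun _ => pow_zero _),
    Finsupp.prod_fintype _ _ (fun _ => pow_zero _)]
  simp [scaleAdd, pow_add, pow_mul, Finset.prod_mul_distrib, mul_assoc, algebraMap_eq]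

theorem coeff_substPow_mul [DecidableEq σ] (d : σ → ℕ) (u : σ →₀ ℕ) (r t : ∀ i, Fin (d i))
    (f : MvPolynomial σ k) :
    coeff (scaleAdd d u t)
      (substPow k d f * monomial (Finsupp.equivFunOnFinite.symm fun i => (r i : ℕ)) 1)
      = if r = t then coeff u f else 0 := by
  induction f using MvPolynomial.induction_on' with
  | monomial v c =>
    rw [substPow_monomial_mul, coeff_monomial, coeff_monomial]
    by_cases h : scaleAdd d v r = scaleAdd d u t
    · obtain ⟨rfl, rfl⟩ := scaleAdd_injective h
      simp
    · rw [if_neg h]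
      split_ifs with h1 h2
      · exact absurd (by rw [h1, h2]) h
      · rfl
      · rfl
  | add p q hp hq =>
    rw [map_add, add_mul, coeff_add, hp, hq, coeff_add]
    split_ifs <;> simp

/-- By division with remainder on exponents, the monomials `x ^ r` with `r i < d i` form a basis
over the image of the substitution. In these coordinates the extended ideal is a product of `∏ d i`
copies of `J`. -/
theorem finrank_quotient_map_substPow {d : σ → ℕ} (hd : ∀ i, 0 < d i)
    (J : Ideal (MvPolynomial σ k)) :
    Module.finrank k (MvPolynomial σ k ⧸ J.map (substPow k d))
      = (∏ i, d i) * Module.finrank k (MvPolynomial σ k ⧸ J) := by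
  classical
  let B := MvPolynomial σ k
  let mon (r : ∀ i, Fin (d i)) : B := monomial (Finsupp.equivFunOnFinite.symm fun i => (r i : ℕ)) 1
  let Θ : ((∀ i, Fin (d i)) → B) →ₗ[k] B :=
    ∑ r, (LinearMap.mulRight k (mon r)) ∘ₗ (substPow k d).toLinearMap ∘ₗ LinearMap.proj r
  have hΘ : ∀ g, Θ g = ∑ r, substPow k d (g r) * mon r := by
    intro g; simp [Θ, LinearMap.sum_apply]
  have hinj : ∀ (g) (t), (∀ u, coeff (scaleAdd d u t) (Θ g) = coeff u (g t)) := by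
    intro g t u
    rw [hΘ, coeff_sum, Finset.sum_congr rfl fun r _ => coeff_substPow_mul d u r t (g r)]
    simp
  have hsurj : ∀ f : B, ∃ g, Θ g = f := by
    intro f
    induction f using MvPolynomial.induction_on' with
    | monomial v c =>
      refine ⟨Pi.single (fun i => ⟨v i % d i, Nat.mod_lt _ (hd i)⟩)
        (monomial (Finsupp.equivFunOnFinite.symm fun i => v i / d i) c), ?_⟩
      rw [hΘ, Finset.sum_eq_single (fun i => ⟨v i % d i, Nat.mod_lt _ (hd i)⟩)]
      · rw [Pi.single_eq_same, substPow_monomial_mul]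
        congr 1
        ext i
        simp [scaleAdd, Nat.div_add_mod]
      · intro r _ hr
        rw [Pi.single_eq_of_ne hr, map_zero, zero_mul]
      · simp
    | add p q hp hq =>
      obtain ⟨g, rfl⟩ := hp
      obtain ⟨g', rfl⟩ := hq
      exact ⟨g + g', map_add _ _ _⟩
  have hmem : ∀ g, Θ g ∈ J.map (substPow k d) ↔ ∀ r, g r ∈ J := by
    intro g
    constructor
    · intro hg
      have key : ∀ f ∈ J.map (substPow k d), ∃ g, Θ g = f ∧ ∀ r, g r ∈ J := by
        intro f hf
        induction hf using Submodule.span_induction with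
        | mem x hx =>
          obtain ⟨j, hj, rfl⟩ := hx
          refine ⟨Pi.single (fun i => ⟨0, hd i⟩) j, ?_, ?_⟩
          · rw [hΘ, Finset.sum_eq_single (fun i => ⟨0, hd i⟩)]
            · rw [Pi.single_eq_same]
              have : mon (fun i => ⟨0, hd i⟩) = 1 := by
                simp only [mon]
                rw [← MvPolynomial.C_1, ← monomial_zero']
                congr 2
                ext i; rfl
              rw [this, mul_one]
            · intro r _ hr
              rw [Pi.single_eq_of_ne hr, map_zero, zero_mul]
            · simp
          · intro r
            by_cases hr : r = (fun i => ⟨0, hd i⟩)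
            · subst hr; simpa using hj
            · rw [Pi.single_eq_of_ne hr]; exact J.zero_mem
        | zero => exact ⟨0, map_zero _, fun _ => J.zero_mem⟩
        | add x y _ _ hx hy =>
          obtain ⟨g, rfl, hg⟩ := hx
          obtain ⟨g', rfl, hg'⟩ := hy
          exact ⟨g + g', map_add _ _ _, fun r => J.add_mem (hg r) (hg' r)⟩
        | smul a x _ hx =>
          obtain ⟨g, rfl, hg⟩ := hx
          -- Re-expanding `mon r * a` in the basis shows that tuples with entries in `J` are stable
          -- under multiplication by `a`.
          choose c hc using fun r => hsurj (mon r * a)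
          refine ⟨fun t => ∑ r, g r * c r t, ?_, fun t =>
            Ideal.sum_mem _ fun r _ => Ideal.mul_mem_right _ _ (hg r)⟩
          rw [hΘ, hΘ, smul_eq_mul, Finset.mul_sum]
          simp only [map_sum, map_mul, Finset.sum_mul]
          rw [Finset.sum_comm]
          refine Finset.sum_congr rfl fun r _ => ?_
          rw [mul_left_comm, mul_comm a, ← hc r, hΘ, Finset.mul_sum]
          exact Finset.sum_congr rfl fun t _ => mul_assoc _ _ _
      obtain ⟨g', hg', hJ⟩ := key _ hg
      have : g = g' := by
        funext t
        ext u
        rw [← hinj, ← hinj, hg']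
      rwa [this]
    · intro hg
      rw [hΘ]
      exact Ideal.sum_mem _ fun r _ => Ideal.mul_mem_right _ _ (Ideal.mem_map_of_mem _ (hg r))
  let F₁ : ((∀ i, Fin (d i)) → B) →ₗ[k] B ⧸ J.map (substPow k d) :=
    (Ideal.Quotient.mkₐ k _).toLinearMap ∘ₗ Θ
  let F₂ : ((∀ i, Fin (d i)) → B) →ₗ[k] ((∀ i, Fin (d i)) → B ⧸ J) :=
    LinearMap.pi fun r => (Ideal.Quotient.mkₐ k J).toLinearMap ∘ₗ LinearMap.proj r
  have hF₁ : Function.Surjective F₁ :=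
    (Ideal.Quotient.mkₐ_surjective k _).comp hsurj
  have hF₂ : Function.Surjective F₂ := by
    intro g
    choose f hf using fun r => Ideal.Quotient.mkₐ_surjective k J (g r)
    exact ⟨f, funext hf⟩
  have hker : LinearMap.ker F₁ = LinearMap.ker F₂ := by
    ext g
    have h₁ : F₁ g = 0 ↔ Θ g ∈ J.map (substPow k d) := Ideal.Quotient.eq_zero_iff_mem
    have h₂ : F₂ g = 0 ↔ ∀ r, g r ∈ J :=
      funext_iff.trans (forall_congr' fun r => Ideal.Quotient.eq_zero_iff_mem)
    rw [LinearMap.mem_ker, LinearMap.mem_ker, h₁, h₂, hmem]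
  have e := (F₁.quotKerEquivOfSurjective hF₁).symm ≪≫ₗ Submodule.quotEquivOfEq _ _ hker ≪≫ₗ
    F₂.quotKerEquivOfSurjective hF₂
  rw [e.finrank_eq, Module.finrank, rank_fun_eq_lift_mul, Cardinal.toNat_mul, Cardinal.toNat_lift,
    Cardinal.toNat_natCast, Fintype.card_pi, Module.finrank]
  simp [B]

end Substitution

/-! ### Dimensions of quotients of polynomial rings -/

section Quotients

open MvPolynomial

variable {k σ C : Type*} [Field k]

/-- Modulo `I`, `ι ∘ ψ` agrees with the identity on the variables, hence everywhere, so `ψ f = 0`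
forces `f ∈ I`. -/
theorem ker_le_of_X_sub_mem [CommRing C] [Algebra k C] (ψ : MvPolynomial σ k →ₐ[k] C)
    (ι : C →ₐ[k] MvPolynomial σ k) {I : Ideal (MvPolynomial σ k)}
    (h : ∀ i, X i - ι (ψ (X i)) ∈ I) : RingHom.ker ψ ≤ I := by
  have key : (Ideal.Quotient.mkₐ k I) = (Ideal.Quotient.mkₐ k I).comp (ι.comp ψ) := by
    ext i
    exact Ideal.Quotient.eq.2 (h i)
  intro f hf
  have hf : ψ f = 0 := hf
  have := DFunLike.congr_fun key f
  rw [AlgHom.comp_apply, AlgHom.comp_apply, hf, map_zero, map_zero] at this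
  exact Ideal.Quotient.eq_zero_iff_mem.1 this

theorem finrank_quotient_map_of_surjective {A : Type*} [CommRing A] [Algebra k A] [CommRing C]
    [Algebra k C] (ψ : A →ₐ[k] C) (hψ : Function.Surjective ψ) {I : Ideal A}
    (hI : RingHom.ker ψ ≤ I) :
    Module.finrank k (C ⧸ I.map ψ) = Module.finrank k (A ⧸ I) := by
  let f : A →ₐ[k] C ⧸ I.map ψ := (Ideal.Quotient.mkₐ k _).comp ψ
  have hf : Function.Surjective f := (Ideal.Quotient.mkₐ_surjective k _).comp hψ
  have hker : RingHom.ker f = I := by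
    have : RingHom.ker f = (I.map ψ).comap ψ := by
      ext x
      exact Ideal.Quotient.eq_zero_iff_mem
    rw [this, Ideal.comap_map_of_surjective' ψ hψ, sup_eq_left]
    exact hI
  exact ((Ideal.quotientEquivAlgOfEq k hker.symm).trans
    (Ideal.quotientKerAlgEquivOfSurjective hf)).toLinearEquiv.finrank_eq.symm

theorem finrank_quotient_span_X :
    Module.finrank k (MvPolynomial σ k ⧸ Ideal.span (Set.range (X : σ → MvPolynomial σ k))) = 1 := by
  let ψ : MvPolynomial σ k →ₐ[k] k := aeval 0
  have hψ : Function.Surjective ψ := fun c => ⟨C c, by simp [ψ]⟩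
  have hker : RingHom.ker ψ = Ideal.span (Set.range (X : σ → MvPolynomial σ k)) := by
    apply le_antisymm
    · refine ker_le_of_X_sub_mem ψ (Algebra.ofId _ _) fun i => ?_
      have : ψ (X i) = 0 := by simp [ψ]
      rw [this, map_zero, sub_zero]
      exact Ideal.subset_span ⟨i, rfl⟩
    · rw [Ideal.span_le]
      rintro _ ⟨i, rfl⟩
      simp [ψ, RingHom.mem_ker]
  rw [((Ideal.quotientEquivAlgOfEq k hker.symm).trans
    (Ideal.quotientKerAlgEquivOfSurjective hψ)).toLinearEquiv.finrank_eq, Module.finrank_self]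

theorem finrank_quotient_span_X_pow [Fintype σ] {M : ℕ} (hM : 0 < M) :
    Module.finrank k (MvPolynomial σ k ⧸
      Ideal.span (Set.range fun i : σ => (X i : MvPolynomial σ k) ^ M)) = M ^ Fintype.card σ := by
  have h := finrank_quotient_map_substPow (k := k) (d := fun _ : σ => M) (fun _ => hM)
    (Ideal.span (Set.range X))
  have hX : substPow k (fun _ : σ => M) ∘ X = fun i => (X i : MvPolynomial σ k) ^ M :=
    funext fun i => substPow_X _ i
  rw [finrank_quotient_span_X, Ideal.map_span, ← Set.range_comp, hX] at h
  simpa using h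

theorem finite_quotient_of_X_pow_mem [Fintype σ] {I : Ideal (MvPolynomial σ k)} {κ : σ → ℕ}
    (h : ∀ i, X i ^ κ i ∈ I) : Module.Finite k (MvPolynomial σ k ⧸ I) := by
  -- One exponent dominating all `κ i`; the `+ 1` keeps it positive.
  set M := ∑ i, κ i + 1 with hM
  have : Module.Finite k (MvPolynomial σ k ⧸
      Ideal.span (Set.range fun i : σ => (X i : MvPolynomial σ k) ^ M)) := by
    apply Module.finite_of_finrank_pos
    rw [finrank_quotient_span_X_pow (by omega)]
    positivity
  have hle : Ideal.span (Set.range fun i : σ => (X i : MvPolynomial σ k) ^ M) ≤ I := by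
    rw [Ideal.span_le]
    rintro _ ⟨i, rfl⟩
    have : κ i ≤ ∑ i, κ i := Finset.single_le_sum (fun _ _ => Nat.zero_le _) (Finset.mem_univ i)
    exact Ideal.pow_mem_of_pow_mem _ (h i) (by omega)
  exact Module.Finite.of_surjective (Ideal.Quotient.factorₐ k hle).toLinearMap
    (Ideal.Quotient.factor_surjective hle)

theorem finrank_quotient_anti {A : Type*} [CommRing A] [Algebra k A] {I J : Ideal A}
    [Module.Finite k (A ⧸ I)] (h : I ≤ J) :
    Module.finrank k (A ⧸ J) ≤ Module.finrank k (A ⧸ I) :=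
  LinearMap.finrank_le_finrank_of_surjective (f := (Ideal.Quotient.factorₐ k h).toLinearMap)
    (Ideal.Quotient.factor_surjective h)

/-- Multiplication by `f` maps `A ⧸ K` to `A ⧸ I`, and its cokernel `A ⧸ (I + (f))` is a quotient of
`A ⧸ J`. -/
theorem finrank_quotient_le_add {A : Type*} [CommRing A] [Algebra k A] {I J K : Ideal A}
    [Module.Finite k (A ⧸ I)] [Module.Finite k (A ⧸ J)] [Module.Finite k (A ⧸ K)] (f : A)
    (hK : ∀ x ∈ K, f * x ∈ I) (hJ : J ≤ I ⊔ Ideal.span {f}) :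
    Module.finrank k (A ⧸ I) ≤ Module.finrank k (A ⧸ J) + Module.finrank k (A ⧸ K) := by
  let g : (A ⧸ K) →ₗ[A] (A ⧸ I) := Submodule.mapQ K I (LinearMap.mulLeft A f) hK
  let g' : (A ⧸ K) →ₗ[k] (A ⧸ I) := g.restrictScalars k
  have hg : ∀ x : A, g' (Ideal.Quotient.mk K x) = Ideal.Quotient.mk I (f * x) := fun _ => rfl
  have h₀ := (LinearMap.range g').finrank_quotient_add_finrank
  have h₁ := LinearMap.finrank_range_le g'
  let c : A →ₗ[k] (A ⧸ I) ⧸ LinearMap.range g' :=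
    (LinearMap.range g').mkQ ∘ₗ (Ideal.Quotient.mkₐ k I).toLinearMap
  have hc : J.restrictScalars k ≤ LinearMap.ker c := by
    intro x hx
    obtain ⟨y, hy, z, hz, rfl⟩ := Submodule.mem_sup.1 (hJ hx)
    obtain ⟨w, rfl⟩ := Ideal.mem_span_singleton'.1 hz
    rw [LinearMap.mem_ker]
    refine (Submodule.Quotient.mk_eq_zero _).2 ⟨Ideal.Quotient.mk K w, ?_⟩
    rw [hg, mul_comm]
    exact Ideal.Quotient.eq.2 (by simpa using I.neg_mem hy)
  have h₂ : Module.finrank k ((A ⧸ I) ⧸ LinearMap.range g') ≤ Module.finrank k (A ⧸ J) := by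
    have e : (A ⧸ J) ≃ₗ[k] A ⧸ J.restrictScalars k :=
      (Submodule.Quotient.restrictScalarsEquiv k J).symm
    rw [e.finrank_eq]
    have : Module.Finite k (A ⧸ J.restrictScalars k) := Module.Finite.equiv e
    refine LinearMap.finrank_le_finrank_of_surjective (f := (J.restrictScalars k).liftQ c hc) ?_
    intro y
    obtain ⟨y, rfl⟩ := Submodule.mkQ_surjective _ y
    obtain ⟨y, rfl⟩ := Ideal.Quotient.mk_surjective y
    exact ⟨Submodule.Quotient.mk y, rfl⟩
  omega

/-- Modulo `∑ X j` and one of the variables, a second variable can be eliminated. -/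
theorem finrank_quotient_le_pow {s M : ℕ} (hM : 0 < M) {i l : Fin s} (hil : i ≠ l)
    {K : Ideal (MvPolynomial (Fin s) k)} (hsum : ∑ j, X j ∈ K) (hi : X i ∈ K)
    (hK : ∀ j, j ≠ i → X j ^ M ∈ K) :
    Module.finrank k (MvPolynomial (Fin s) k ⧸ K) ≤ M ^ (s - 2) := by
  classical
  let τ := {j : Fin s // j ∉ ({i, l} : Finset (Fin s))}
  have hcard : Fintype.card τ = s - 2 := by
    rw [Fintype.card_of_subtype ({i, l} : Finset (Fin s))ᶜ fun _ => Finset.mem_compl,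
      Finset.card_compl, Finset.card_pair hil, Fintype.card_fin]
  let ψ : MvPolynomial τ k →ₐ[k] (MvPolynomial (Fin s) k ⧸ K) :=
    (Ideal.Quotient.mkₐ k K).comp (rename Subtype.val)
  have hψX : ∀ j : τ, ψ (X j) = Ideal.Quotient.mkₐ k K (X j.1) := fun j => by simp [ψ]
  have hother : ∀ j, j ≠ l → Ideal.Quotient.mkₐ k K (X j) ∈ ψ.range := by
    intro j hj
    by_cases hji : j = i
    · subst hji
      rw [Ideal.Quotient.mkₐ_eq_mk, Ideal.Quotient.eq_zero_iff_mem.2 hi]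
      exact zero_mem _
    · exact ⟨X ⟨j, by simp [hj, hji]⟩, hψX _⟩
  have hl : Ideal.Quotient.mkₐ k K (X l) ∈ ψ.range := by
    have h0 : Ideal.Quotient.mkₐ k K (∑ j, X j) = 0 := Ideal.Quotient.eq_zero_iff_mem.2 hsum
    rw [← Finset.add_sum_erase _ _ (Finset.mem_univ l), map_add, map_sum] at h0
    rw [eq_neg_of_add_eq_zero_left h0]
    exact neg_mem (sum_mem fun j hj => hother j (Finset.ne_of_mem_erase hj))
  have hall : (Ideal.Quotient.mkₐ k K).range ≤ ψ.range := by
    rw [← Algebra.map_top, ← MvPolynomial.adjoin_range_X, AlgHom.map_adjoin, Algebra.adjoin_le_iff]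
    rintro _ ⟨_, ⟨j, rfl⟩, rfl⟩
    by_cases hj : j = l
    · exact hj ▸ hl
    · exact hother j hj
  have hsurj : Function.Surjective ψ := by
    intro y
    obtain ⟨x, rfl⟩ := Ideal.Quotient.mkₐ_surjective k K y
    exact hall ⟨x, rfl⟩
  let P := Ideal.span (Set.range fun j : τ => (X j : MvPolynomial τ k) ^ M)
  have : Module.Finite k (MvPolynomial τ k ⧸ P) :=
    finite_quotient_of_X_pow_mem (κ := fun _ => M) fun j => Ideal.subset_span ⟨j, rfl⟩
  have hP : ∀ x ∈ P, ψ x = 0 := by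
    have : P ≤ RingHom.ker ψ := by
      rw [Ideal.span_le]
      rintro _ ⟨j, rfl⟩
      have hj : j.1 ≠ i := fun h => j.2 (by simp [h])
      rw [SetLike.mem_coe, RingHom.mem_ker, map_pow, hψX, ← map_pow]
      exact Ideal.Quotient.eq_zero_iff_mem.2 (hK _ hj)
    exact this
  rw [← hcard, ← finrank_quotient_span_X_pow (k := k) hM]
  refine LinearMap.finrank_le_finrank_of_surjective
    (f := (Ideal.Quotient.liftₐ P ψ hP).toLinearMap) ?_
  exact Ideal.Quotient.lift_surjective_of_surjective P hP hsurj

end Quotients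

/-! ### Growth of `D`, Frobenius scaling, and comparison with `e` -/

section Colength

open MvPolynomial

variable {p s : ℕ}

/-- The substitution of `-∑ X j` for the first variable. -/
noncomputable def elim (p m : ℕ) :
    MvPolynomial (Fin (m + 1)) (ZMod p) →ₐ[ZMod p] MvPolynomial (Fin m) (ZMod p) :=
  aeval (Fin.cons (-∑ j, X j) X)

theorem elim_X_zero (m : ℕ) : elim p m (X 0) = -∑ j, X j := by simp [elim]

theorem elim_X_succ (m : ℕ) (j : Fin m) : elim p m (X j.succ) = X j := by simp [elim]

variable [Fact p.Prime]

theorem X_pow_mem_powIdeal (f : MvPolynomial (Fin s) (ZMod p)) {κ κ' : Fin s → ℕ} {i : Fin s}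
    (h : κ i ≤ κ' i) : X i ^ κ' i ∈ powIdeal f κ :=
  Ideal.pow_mem_of_pow_mem _ (Ideal.subset_span (Set.mem_insert_of_mem _ ⟨i, rfl⟩)) h

theorem mem_powIdeal (f : MvPolynomial (Fin s) (ZMod p)) (κ : Fin s → ℕ) : f ∈ powIdeal f κ :=
  Ideal.subset_span (Set.mem_insert _ _)

theorem powIdeal_le {f : MvPolynomial (Fin s) (ZMod p)} {κ : Fin s → ℕ}
    {I : Ideal (MvPolynomial (Fin s) (ZMod p))} (hf : f ∈ I) (h : ∀ i, X i ^ κ i ∈ I) :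
    powIdeal f κ ≤ I := by
  refine Ideal.span_le.2 (Set.insert_subset hf ?_)
  rintro _ ⟨i, rfl⟩
  exact h i

instance (f : MvPolynomial (Fin s) (ZMod p)) (κ : Fin s → ℕ) :
    Module.Finite (ZMod p) (MvPolynomial (Fin s) (ZMod p) ⧸ powIdeal f κ) :=
  finite_quotient_of_X_pow_mem fun _ => X_pow_mem_powIdeal f le_rfl

theorem colength_powIdeal (f : MvPolynomial (Fin s) (ZMod p)) (κ : Fin s → ℕ) :
    colength (powIdeal f κ)
      = Module.finrank (ZMod p) (MvPolynomial (Fin s) (ZMod p) ⧸ powIdeal f κ) := by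
  rw [colength, length_eq_length_field (Module.length_ne_top_iff.1 (length_ne_top f κ)),
    Module.length_eq_finrank, ENat.toNat_natCast]
  intro i
  refine ⟨κ i, fun m => ?_⟩
  obtain ⟨m, rfl⟩ := Ideal.Quotient.mk_surjective m
  exact Ideal.Quotient.eq_zero_iff_mem.2 (Ideal.mul_mem_right _ _ (X_pow_mem_powIdeal f le_rfl))

theorem colength_powIdeal_mono (f : MvPolynomial (Fin s) (ZMod p)) {κ κ' : Fin s → ℕ}
    (h : ∀ i, κ i ≤ κ' i) : colength (powIdeal f κ) ≤ colength (powIdeal f κ') := by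
  rw [colength_powIdeal, colength_powIdeal]
  exact finrank_quotient_anti
    (powIdeal_le (mem_powIdeal f κ) fun i => X_pow_mem_powIdeal f (h i))

theorem D_mono {κ κ' : Fin s → ℕ} (h : ∀ i, κ i ≤ κ' i) : D p κ ≤ D p κ' :=
  colength_powIdeal_mono _ h

/-- Multiplication by `X i ^ κ i` has cokernel of dimension `D p κ` and factors through the quotient
in which the exponent of `X i` is 1. There the linear relation removes a second variable, leaving `s
- 2` of them. -/
theorem D_update_succ_le (hs : 2 ≤ s) {κ : Fin s → ℕ} {M : ℕ} (hM : 0 < M)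
    (hκ : ∀ i, κ i ≤ M) (i : Fin s) :
    D p (Function.update κ i (κ i + 1)) ≤ D p κ + M ^ (s - 2) := by
  have : Nontrivial (Fin s) := Fin.nontrivial_iff_two_le.2 hs
  obtain ⟨l, hl⟩ := exists_ne i
  let K := powIdeal (p := p) (∑ j, X j) (Function.update κ i 1)
  have hKi : X i ∈ K := by
    have := X_pow_mem_powIdeal (p := p) (∑ j, X j) (le_refl (Function.update κ i 1 i))
    rwa [Function.update_self, pow_one] at this
  have hKM : Module.finrank (ZMod p) (MvPolynomial (Fin s) (ZMod p) ⧸ K) ≤ M ^ (s - 2) := by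
    refine finrank_quotient_le_pow hM hl.symm (mem_powIdeal _ _) hKi fun j hj => ?_
    refine X_pow_mem_powIdeal (κ' := fun _ => M) _ ?_
    rw [Function.update_of_ne hj]
    exact hκ j
  rw [D, D, colength_powIdeal, colength_powIdeal]
  refine le_trans (finrank_quotient_le_add (K := K) (X i ^ κ i) ?_ ?_) (Nat.add_le_add_left hKM _)
  · have : K ≤ Submodule.comap
        (LinearMap.mulLeft (MvPolynomial (Fin s) (ZMod p)) (X i ^ κ i : MvPolynomial (Fin s) (ZMod p)))
        (powIdeal (∑ j, X j) (Function.update κ i (κ i + 1))) := by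
      refine powIdeal_le ?_ fun j => ?_
      · exact Ideal.mul_mem_left _ _ (mem_powIdeal _ _)
      · by_cases hj : j = i
        · subst hj
          have := X_pow_mem_powIdeal (p := p) (∑ j, X j)
            (le_refl (Function.update κ j (κ j + 1) j))
          rw [Function.update_self, pow_succ] at this
          simpa using this
        · refine Ideal.mul_mem_left _ _ (X_pow_mem_powIdeal _ ?_)
          simp [Function.update_of_ne hj]
    exact fun x hx => this hx
  · refine powIdeal_le (Ideal.mem_sup_left (mem_powIdeal _ _)) fun j => ?_
    by_cases hj : j = i
    · subst hj
      exact Ideal.mem_sup_right (Ideal.mem_span_singleton_self _)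
    · refine Ideal.mem_sup_left (X_pow_mem_powIdeal _ ?_)
      simp [Function.update_of_ne hj]

theorem D_add_indicator_le (hs : 2 ≤ s) {κ : Fin s → ℕ} {M : ℕ} (hκ : ∀ i, κ i + 1 ≤ M)
    (S : Finset (Fin s)) :
    D p (fun i => κ i + if i ∈ S then 1 else 0) ≤ D p κ + S.card * M ^ (s - 2) := by
  induction S using Finset.induction_on with
  | empty => simp
  | insert i S hi ih =>
    have hM : 0 < M := (Nat.succ_pos _).trans_le (hκ i)
    have h := D_update_succ_le (p := p) hs (κ := fun i => κ i + if i ∈ S then 1 else 0) hM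
      (fun j => (Nat.add_le_add_left (by split_ifs <;> simp) _).trans (hκ j)) i
    have heq : Function.update (fun i => κ i + if i ∈ S then 1 else 0) i
        ((κ i + if i ∈ S then 1 else 0) + 1) = fun j => κ j + if j ∈ insert i S then 1 else 0 := by
      funext j
      by_cases hj : j = i
      · subst hj; simp [hi]
      · simp [hj]
    rw [heq] at h
    rw [Finset.card_insert_of_notMem hi, add_mul, one_mul]
    omega

theorem D_add_const_le (hs : 2 ≤ s) {M : ℕ} (t : ℕ) {κ : Fin s → ℕ} (hκ : ∀ i, κ i + t ≤ M) :
    D p (fun i => κ i + t) ≤ D p κ + s * t * M ^ (s - 2) := by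
  induction t with
  | zero => simp
  | succ t ih =>
    have h := D_add_indicator_le (p := p) hs (κ := fun i => κ i + t) (M := M)
      (fun i => hκ i) Finset.univ
    have ih := ih fun i => by have := hκ i; omega
    simp only [Finset.mem_univ, if_true, Finset.card_univ, Fintype.card_fin] at h
    calc D p (fun i => κ i + (t + 1)) ≤ D p (fun i => κ i + t) + s * M ^ (s - 2) := h
      _ ≤ D p κ + s * t * M ^ (s - 2) + s * M ^ (s - 2) := Nat.add_le_add_right ih _
      _ = _ := by ring

theorem map_powIdeal {C F : Type*} [CommRing C] [FunLike F (MvPolynomial (Fin s) (ZMod p)) C]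
    [RingHomClass F (MvPolynomial (Fin s) (ZMod p)) C] (φ : F)
    (f : MvPolynomial (Fin s) (ZMod p)) (κ : Fin s → ℕ) :
    (powIdeal f κ).map φ = Ideal.span (insert (φ f) (Set.range fun i => φ (X i) ^ κ i)) := by
  rw [powIdeal, Ideal.map_span, Set.image_insert_eq, ← Set.range_comp]
  simp only [Function.comp_def, map_pow]

theorem colength_diagonal {d : Fin s → ℕ} (hd : ∀ i, 0 < d i) (κ : Fin s → ℕ) :
    colength (powIdeal (diagonal p d) fun i => d i * κ i) = (∏ i, d i) * D p κ := by
  have h : (powIdeal (p := p) (∑ i, X i) κ).map (substPow (ZMod p) d)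
      = powIdeal (diagonal p d) fun i => d i * κ i := by
    rw [map_powIdeal]
    simp only [powIdeal, diagonal, map_sum, substPow_X, pow_mul]
  rw [D, colength_powIdeal, colength_powIdeal, ← finrank_quotient_map_substPow hd, h]

/-- Eliminating a variable leaves an ideal generated by powers of linear forms. Frobenius scales
their exponents, whereas it would have replaced the relation `∑ X j` by its `p`-th power. -/
theorem D_eq_finrank_map_elim {m : ℕ} (κ : Fin (m + 1) → ℕ) :
    D p κ = Module.finrank (ZMod p) (MvPolynomial (Fin m) (ZMod p) ⧸
      Ideal.span (Set.range fun i => elim p m (X i) ^ κ i)) := by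
  have hsurj : Function.Surjective (elim p m) := by
    intro f
    refine ⟨rename Fin.succ f, ?_⟩
    have : (elim p m).comp (rename Fin.succ) = AlgHom.id _ _ := by
      ext j
      simp [elim_X_succ]
    exact DFunLike.congr_fun this f
  have hker : RingHom.ker (elim p m) ≤ powIdeal (p := p) (∑ j, X j) κ := by
    refine ker_le_of_X_sub_mem (elim p m) (rename Fin.succ) fun i => ?_
    induction i using Fin.cases with
    | zero =>
      rw [elim_X_zero]
      have := mem_powIdeal (p := p) (∑ j, X j) κ
      rw [Fin.sum_univ_succ] at this
      simpa [Fin.sum_univ_succ] using this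
    | succ j => simp [elim_X_succ]
  have hzero : elim p m (∑ j, X j) = 0 := by
    rw [Fin.sum_univ_succ, map_add, map_sum, elim_X_zero]
    simp [elim_X_succ]
  rw [D, colength_powIdeal, ← finrank_quotient_map_of_surjective _ hsurj hker, map_powIdeal, hzero,
    Ideal.span_insert_zero]

/-- Over `ℤ/p` the substitution `X i ↦ X i ^ p` is `f ↦ f ^ p`, and it is free of rank `p ^ (s - 1)`
in the `s - 1` remaining variables. -/
theorem D_prime_mul (hs : 2 ≤ s) (κ : Fin s → ℕ) :
    D p (fun i => p * κ i) = p ^ (s - 1) * D p κ := by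
  obtain ⟨m, rfl⟩ : ∃ m, s = m + 1 := ⟨s - 1, by omega⟩
  have hp : 0 < p := (Fact.out : p.Prime).pos
  have hF : ∀ f : MvPolynomial (Fin m) (ZMod p), substPow (ZMod p) (fun _ => p) f = f ^ p :=
    fun f => expand_zmod f
  have h := finrank_quotient_map_substPow (k := ZMod p) (d := fun _ : Fin m => p) (fun _ => hp)
    (Ideal.span (Set.range fun i => elim p m (X i) ^ κ i))
  have hmap : (Ideal.span (Set.range fun i => elim p m (X i) ^ κ i)).map
      (substPow (ZMod p) fun _ => p) = Ideal.span (Set.range fun i => elim p m (X i) ^ (p * κ i)) := by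
    rw [Ideal.map_span, ← Set.range_comp]
    simp only [Function.comp_def, hF, ← pow_mul, mul_comm]
  rw [← D_eq_finrank_map_elim, hmap, ← D_eq_finrank_map_elim] at h
  simpa using h

theorem D_prime_pow_mul (hs : 2 ≤ s) (κ : Fin s → ℕ) (j : ℕ) :
    D p (fun i => p ^ j * κ i) = (p ^ j) ^ (s - 1) * D p κ := by
  induction j with
  | zero => simp
  | succ j ih =>
    have := D_prime_mul (p := p) hs (fun i => p ^ j * κ i)
    simp only [← mul_assoc, ← pow_succ'] at this
    rw [this, ih, ← mul_assoc, ← mul_pow, ← pow_succ']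

theorem e_diagonal_le (hs : 2 ≤ s) {d : Fin s → ℕ} (hd : ∀ i, 0 < d i) {κ : Fin s → ℕ}
    {n t M : ℕ} (hq : ∀ i, p ^ n ≤ d i * (κ i + t)) (hM : ∀ i, κ i + t ≤ M) :
    e (diagonal p d) n ≤ (∏ i, d i) * (D p κ + s * t * M ^ (s - 2)) := by
  refine (colength_powIdeal_mono _ hq).trans ?_
  rw [colength_diagonal hd fun i => κ i + t]
  exact Nat.mul_le_mul_left _ (D_add_const_le hs t hM)

theorem le_e_diagonal (hs : 2 ≤ s) {d : Fin s → ℕ} (hd : ∀ i, 0 < d i) {κ : Fin s → ℕ}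
    {n t M : ℕ} (hq : ∀ i, d i * κ i ≤ p ^ n + d i * t) (hM : ∀ i, κ i + t ≤ M) :
    (∏ i, d i) * D p κ ≤ e (diagonal p d) n + (∏ i, d i) * (s * t * M ^ (s - 2)) := by
  -- Truncated subtraction is harmless: `κ i - t + t` is the maximum of `κ i` and `t`, so it lies
  -- between `κ i` and `M`.
  have h₁ : D p κ ≤ D p (fun i => κ i - t) + s * t * M ^ (s - 2) :=
    (D_mono (κ' := fun i => κ i - t + t) fun i => by omega).trans
      (D_add_const_le (κ := fun i => κ i - t) (M := M) hs t fun i => by have := hM i; omega)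
  have h₂ : (∏ i, d i) * D p (fun i => κ i - t) ≤ e (diagonal p d) n := by
    rw [← colength_diagonal hd]
    refine colength_powIdeal_mono _ fun i => ?_
    rw [Nat.mul_sub]
    exact Nat.sub_le_of_le_add (hq i)
  calc _ ≤ (∏ i, d i) * (D p (fun i => κ i - t) + s * t * M ^ (s - 2)) :=
        Nat.mul_le_mul_left _ h₁
    _ ≤ _ := by rw [mul_add]; exact Nat.add_le_add_right h₂ _

end Colength

/-! ### Uniform estimates and the limit -/

variable {p s : ℕ} [Fact p.Prime]

/-- A tuple `κ` within `N` of `p ^ n / d` determines all later normalized colengths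
`e_m / q ^ (s - 1)` up to a multiple of `p ^ (-n)` that depends only on `s`, `d` and `N`. -/
theorem abs_e_diagonal_div_sub_le (hs : 2 ≤ s) {d : Fin s → ℕ} (hd : ∀ i, 0 < d i)
    {κ : Fin s → ℕ} {n m N : ℕ} (hnm : n ≤ m) (hle : ∀ i, d i * κ i ≤ p ^ n + d i * N)
    (hge : ∀ i, p ^ n ≤ d i * (κ i + N)) :
    |(e (diagonal p d) m : ℝ) / ((p : ℝ) ^ m) ^ (s - 1)
        - (∏ i, (d i : ℝ)) * D p κ / ((p : ℝ) ^ n) ^ (s - 1)|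
      ≤ (∏ i, (d i : ℝ)) * s * N * (1 + 2 * N) ^ (s - 2) / (p : ℝ) ^ n := by
  obtain ⟨j, rfl⟩ := Nat.exists_eq_add_of_le hnm
  obtain ⟨r, rfl⟩ := Nat.exists_eq_add_of_le' hs
  have hp : 0 < p := (Fact.out : p.Prime).pos
  have hκ : ∀ i, κ i ≤ p ^ n + N := by
    intro i
    refine Nat.le_of_mul_le_mul_left ((hle i).trans ?_) (hd i)
    rw [mul_add]
    exact Nat.add_le_add_right (Nat.le_mul_of_pos_left _ (hd i)) _
  -- The bound is a multiple of `p ^ (n + j)`, so that normalization cancels every `p ^ j`; `κ i + N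
  -- ≤ p ^ n + 2 * N` gives the factor `1 + 2 * N`.
  have hM : ∀ i, p ^ j * κ i + p ^ j * N ≤ p ^ n * p ^ j * (1 + 2 * N) := by
    intro i
    have h1 : 1 ≤ p ^ n := Nat.one_le_pow _ _ hp
    have h2 : κ i + N ≤ p ^ n * (1 + 2 * N) := by nlinarith [hκ i]
    calc p ^ j * κ i + p ^ j * N = p ^ j * (κ i + N) := by ring
      _ ≤ p ^ j * (p ^ n * (1 + 2 * N)) := Nat.mul_le_mul_left _ h2
      _ = _ := by ring
  have hu := e_diagonal_le (p := p) hs hd (κ := fun i => p ^ j * κ i) (n := n + j)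
    (t := p ^ j * N) (fun i => by
      calc p ^ (n + j) = p ^ j * p ^ n := by ring
        _ ≤ p ^ j * (d i * (κ i + N)) := Nat.mul_le_mul_left _ (hge i)
        _ = _ := by ring) hM
  have hl := le_e_diagonal (p := p) hs hd (κ := fun i => p ^ j * κ i) (n := n + j)
    (t := p ^ j * N) (fun i => by
      calc d i * (p ^ j * κ i) = p ^ j * (d i * κ i) := by ring
        _ ≤ p ^ j * (p ^ n + d i * N) := Nat.mul_le_mul_left _ (hle i)
        _ = _ := by ring) hM
  rw [D_prime_pow_mul hs] at hu hl
  simp only [Nat.add_sub_cancel, show r + 2 - 1 = r + 1 by omega] at hu hl ⊢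
  have hu' : (e (diagonal p d) (n + j) : ℝ) ≤ (∏ i, (d i : ℝ)) * (((p : ℝ) ^ j) ^ (r + 1) * D p κ
      + (r + 2 : ℕ) * ((p : ℝ) ^ j * N) * ((p : ℝ) ^ n * p ^ j * (1 + 2 * N)) ^ r) := by
    exact_mod_cast hu
  have hl' : (∏ i, (d i : ℝ)) * (((p : ℝ) ^ j) ^ (r + 1) * D p κ) ≤ (e (diagonal p d) (n + j) : ℝ)
      + (∏ i, (d i : ℝ)) *
        ((r + 2 : ℕ) * ((p : ℝ) ^ j * N) * ((p : ℝ) ^ n * p ^ j * (1 + 2 * N)) ^ r) := by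
    exact_mod_cast hl
  have hR : (0 : ℝ) < (p : ℝ) ^ j := by positivity
  have hQ : (0 : ℝ) < (p : ℝ) ^ n := by positivity
  rw [pow_add (p : ℝ) n j]
  generalize (p : ℝ) ^ j = R at *
  generalize (p : ℝ) ^ n = Q at *
  generalize (∏ i, (d i : ℝ)) = P at *
  generalize (e (diagonal p d) (n + j) : ℝ) = E at *
  generalize (D p κ : ℝ) = D₀ at *
  have h₁ : E / (Q * R) ^ (r + 1) - P * D₀ / Q ^ (r + 1)
      = (E - P * (R ^ (r + 1) * D₀)) / (Q * R) ^ (r + 1) := by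
    field_simp
    ring
  have h₂ : P * (r + 2 : ℕ) * N * (1 + 2 * N) ^ r / Q
      = P * ((r + 2 : ℕ) * (R * N) * (Q * R * (1 + 2 * N)) ^ r) / (Q * R) ^ (r + 1) := by
    rw [mul_pow (Q * R)]
    field_simp
    ring
  rw [h₁, h₂, abs_div, abs_of_pos (by positivity : 0 < (Q * R) ^ (r + 1))]
  gcongr
  rw [abs_le]
  constructor <;> linarith

/-- Both terms are compared with the same `D p κ`, where `κ i = p ^ n / d i` is rounded down. Hence
`N = 1`, and the 3 is `1 + 2 * N`. -/
theorem dist_e_diagonal_div_le (hs : 2 ≤ s) {d : Fin s → ℕ} (hd : ∀ i, 0 < d i) {n m l : ℕ}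
    (hm : n ≤ m) (hl : n ≤ l) :
    dist ((e (diagonal p d) m : ℝ) / ((p : ℝ) ^ m) ^ (s - 1))
        ((e (diagonal p d) l : ℝ) / ((p : ℝ) ^ l) ^ (s - 1))
      ≤ 2 * ((∏ i, (d i : ℝ)) * s * 3 ^ (s - 2)) / (p : ℝ) ^ n := by
  have key : ∀ {m}, n ≤ m → _ := fun {m} hm => abs_e_diagonal_div_sub_le (p := p) hs hd
    (κ := fun i => p ^ n / d i) (n := n) (m := m) (N := 1) hm
    (fun i => (Nat.mul_div_le _ _).trans (Nat.le_add_right _ _))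
    (fun i => (Nat.lt_mul_div_succ _ (hd i)).le)
  have h₁ := key hm
  have h₂ := key hl
  rw [← Real.dist_eq] at h₁ h₂
  refine (dist_triangle_right _ _ _).trans ((add_le_add h₁ h₂).trans (le_of_eq ?_))
  norm_num
  ring

theorem tendsto_e_diagonal_div (hs : 2 ≤ s) {d : Fin s → ℕ} (hd : ∀ i, 0 < d i) :
    Tendsto (fun n : ℕ => (e (diagonal p d) n : ℝ) / ((p : ℝ) ^ n) ^ (s - 1)) atTop
      (𝓝 (multiplicity (diagonal p d))) := by
  have hp : 1 < (p : ℝ) := by exact_mod_cast (Fact.out : p.Prime).one_lt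
  have hc : CauchySeq fun n : ℕ => (e (diagonal p d) n : ℝ) / ((p : ℝ) ^ n) ^ (s - 1) :=
    cauchySeq_of_le_tendsto_0 _ (fun _ _ _ => dist_e_diagonal_div_le hs hd)
      (tendsto_const_nhds.div_atTop (tendsto_pow_atTop_atTop_of_one_lt hp))
  exact hc.tendsto_limUnder

theorem e_diagonal_sub_isBigO (hs : 2 ≤ s) {d : Fin s → ℕ} (hd : ∀ i, 0 < d i) :
    (fun n : ℕ => (e (diagonal p d) n : ℝ)
        - multiplicity (diagonal p d) * ((p : ℝ) ^ n) ^ (s - 1))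
      =O[atTop] fun n : ℕ => ((p : ℝ) ^ n) ^ (s - 2) := by
  have hp : 0 < (p : ℝ) := by exact_mod_cast (Fact.out : p.Prime).pos
  refine IsBigO.of_bound (2 * ((∏ i, (d i : ℝ)) * s * 3 ^ (s - 2))) (Eventually.of_forall fun n => ?_)
  -- With the first index fixed at `n` and the second tending to infinity, the Cauchy estimate
  -- bounds the distance to the limit by a multiple of `1 / q`.
  have h := le_of_tendsto (tendsto_const_nhds.dist (tendsto_e_diagonal_div (p := p) hs hd))
    ((eventually_ge_atTop n).mono fun m hm =>
      dist_e_diagonal_div_le (p := p) hs hd (le_refl n) hm)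
  obtain ⟨r, rfl⟩ := Nat.exists_eq_add_of_le' hs
  simp only [Nat.add_sub_cancel, show r + 2 - 1 = r + 1 by omega] at h ⊢
  have hQ : (0 : ℝ) < (p : ℝ) ^ n := by positivity
  rw [Real.dist_eq] at h
  generalize (p : ℝ) ^ n = Q at *
  have h₁ : (e (diagonal p d) n : ℝ) - multiplicity (diagonal p d) * Q ^ (r + 1)
      = ((e (diagonal p d) n : ℝ) / Q ^ (r + 1) - multiplicity (diagonal p d)) * Q ^ (r + 1) := by
    field_simp
  rw [h₁, norm_mul, Real.norm_eq_abs, Real.norm_of_nonneg (by positivity),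
    Real.norm_of_nonneg (by positivity)]
  refine (mul_le_mul_of_nonneg_right h (by positivity)).trans (le_of_eq ?_)
  field_simp
  ring

theorem abs_multiplicity_diagonal_sub_le (hs : 2 ≤ s) {d : Fin s → ℕ} (hd : ∀ i, 0 < d i)
    {a : Fin s → ℕ} {N : ℕ} (ha : ∀ i, |(a i : ℝ) - (p : ℝ) / d i| ≤ N) :
    |multiplicity (diagonal p d) - (∏ i, (d i : ℝ)) * (p : ℝ) ^ (1 - (s : ℤ)) * D p a|
      ≤ (∏ i, (d i : ℝ)) * s * N * (1 + 2 * N) ^ (s - 2) / p := by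
  have hbound : ∀ i, d i * a i ≤ p ^ 1 + d i * N ∧ p ^ 1 ≤ d i * (a i + N) := by
    intro i
    have hdi : (0 : ℝ) < d i := by exact_mod_cast hd i
    obtain ⟨h₁, h₂⟩ := abs_le.1 (ha i)
    have hdiv : (d i : ℝ) * (p / d i) = p := by field_simp
    constructor
    · have : (d i : ℝ) * a i ≤ p ^ 1 + d i * N := by nlinarith
      exact_mod_cast this
    · have : (p : ℝ) ^ 1 ≤ d i * (a i + N) := by nlinarith
      exact_mod_cast this
  -- The uniform estimate at `n = 1` with `κ = a`, as `m` tends to infinity.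
  have h := le_of_tendsto (((tendsto_e_diagonal_div (p := p) hs hd).sub_const
      ((∏ i, (d i : ℝ)) * D p a / ((p : ℝ) ^ 1) ^ (s - 1))).abs)
    ((eventually_ge_atTop 1).mono fun m hm =>
      abs_e_diagonal_div_sub_le hs hd hm (fun i => (hbound i).1) (fun i => (hbound i).2))
  have hz : (p : ℝ) ^ (1 - (s : ℤ)) = ((p : ℝ) ^ (s - 1))⁻¹ := by
    rw [← zpow_natCast, ← zpow_neg]
    congr 1
    omega
  rw [pow_one] at h
  rw [hz, mul_right_comm, ← div_eq_mul_inv]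
  exact h

end HilbertKunz

theorem theorem1p5 (s : ℕ) (hs : 2 ≤ s) (d : Fin s → ℕ) (hd : ∀ i, 1 < d i)
    (a : ℕ → Fin s → ℕ)
    (ha : ∃ C : ℝ, ∀ p : ℕ, p.Prime → ∀ i, |(a p i : ℝ) - (p : ℝ) / (d i : ℝ)| ≤ C) :
    -- the limit `μ` exists, with `e_n = μ q ^ (s - 1) + O(q ^ (s - 2))` for each fixed `p`
    (∀ p : ℕ, p.Prime →
      (fun n : ℕ => (HilbertKunz.e (HilbertKunz.diagonal p d) n : ℝ)
          - HilbertKunz.multiplicity (HilbertKunz.diagonal p d) * ((p : ℝ) ^ n) ^ (s - 1))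
        =O[atTop] fun n : ℕ => ((p : ℝ) ^ n) ^ (s - 2)) ∧
    ∃ k : ℝ, ∀ p : ℕ, p.Prime →
      |HilbertKunz.multiplicity (HilbertKunz.diagonal p d)
        - (∏ i, (d i : ℝ)) * (p : ℝ) ^ (1 - (s : ℤ)) * (HilbertKunz.D p (a p) : ℝ)|
          ≤ k / (p : ℝ) := by
  have hd' : ∀ i, 0 < d i := fun i => Nat.zero_lt_of_lt (hd i)
  obtain ⟨C, hC⟩ := ha
  -- The bound is rounded up to a natural number because it serves as a shift of exponents.
  obtain ⟨N, hN⟩ := exists_nat_ge C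
  refine ⟨fun p hp => ?_, (∏ i, (d i : ℝ)) * s * N * (1 + 2 * N) ^ (s - 2), fun p hp => ?_⟩
  · have : Fact p.Prime := ⟨hp⟩
    exact HilbertKunz.e_diagonal_sub_isBigO hs hd'
  · have : Fact p.Prime := ⟨hp⟩
    exact HilbertKunz.abs_multiplicity_diagonal_sub_le hs hd' fun i => (hC p hp i).trans hN
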